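/- **Conventions.** A *valued differential field* $(K,\Gamma;v)$ is a field $K$ with a derivation $f\mapsto f'$ and a surjective (Krull) valuation $v:K^\times\to\Gamma$ onto an ordered abelian group $\Gamma$, whose residue field $\mathcal O/\mathfrak m$ has characteristic $0$; here $\mathcal O=\{f: v(f)\ge 0\}$ (with $v(0)=\infty$) and $\mathfrak m$ is its maximal ideal. It is *monotone* if $v(f')\ge v(f)$ for all $f\in K$; then $\mathcal O$ and $\mathfrak m$ are closed under the derivation, and the residue field carries the induced derivation. It is *differential-henselian* if every differential polynomial $P\in\mathcal O\{Y\}=\mathcal O[Y,Y',Y'',\dots]$ whose reduction over the residue field has total degree $1$ has a zero in $\mathcal O$. A *lift of the differential residue field* is a differential subfield $\boldsymbol k$ of $K$ contained in $\mathcal O$ that the residue map $\mathcal O\to\mathcal O/\mathfrak m$ maps isomorphically onto the residue field. For $f\in K^\times$ put $f^\dagger=f'/f$. A *cross-section* of $v$ is a group morphism $s:\Gamma\to K^\times$ with $v(s(\gamma))=\gamma$ for all $\gamma\in\Gamma$. The two-sorted structure $((K,\boldsymbol k),\Gamma;v)$ consists of the differential field $K$ with the distinguished subset $\boldsymbol k$,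 the ordered abelian group $\Gamma$, and the map $v$; it is *$\aleph_1$-saturated* if, for every countable set of parameters and either of the two sorts, every finitely satisfiable set of first-order formulas over these parameters in one free variable of that sort is realized in the structure. **Theorem 3.5.** Let $(K,\Gamma;v)$ be a monotone differential-henselian valued differential field and let $\boldsymbol k$ be a lift of its differential residue field. Suppose the two-sorted structure $((K,\boldsymbol k),\Gamma;v)$ is $\aleph_1$-saturated. Then there are a cross-section $s:\Gamma\to K^\times$ of $v$ and an additive map $c:\Gamma\to\boldsymbol k$ such that $s(\gamma)^\dagger=c(\gamma)$ for all $\gamma\in\Gamma$. -/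

import Mathlib

open scoped Differential

/-! ### Saturation of first-order structures -/

namespace FirstOrder.Language

/-- `M` is `κ`-saturated: for every parameter set `A ⊆ M` of cardinality `< κ`, every set `p` of
`L`-formulas over `A` in one free variable that is finitely satisfiable in `M` is realized in `M`.
The variables indexed by `A` are interpreted by the parameters themselves, and the variable
indexed by `Unit` is the free one. -/
def IsSaturated (L : Language.{0, 0}) (M : Type*) [L.Structure M] (κ : Cardinal) : Prop :=
  ∀ A : Set M, Cardinal.mk A < κ → ∀ p : Set (L.Formula (A ⊕ Unit)),
    (∀ q ⊆ p, q.Finite → ∃ x : M, ∀ φ ∈ q, φ.Realize (Sum.elim Subtype.val fun _ => x)) →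
    ∃ x : M, ∀ φ ∈ p, φ.Realize (Sum.elim Subtype.val fun _ => x)

end FirstOrder.Language

namespace ValDiff

variable {K Γ : Type*} [Field K] [AddCommGroup Γ] [LinearOrder Γ] [IsOrderedAddMonoid Γ]

/-! ### Valued differential fields

Valuations are written additively, `v : AddValuation K (WithTop Γ)`, with `v a = ⊤` exactly when
`a = 0`; so `v` restricts to a map from the nonzero elements of `K` to `Γ`. -/

/-- The valuation ring `𝒪 = {a : v a ≥ 0}`. -/
abbrev valRing (v : AddValuation K (WithTop Γ)) : ValuationSubring K :=
  v.toValuation.valuationSubring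

theorem mem_valRing_iff (v : AddValuation K (WithTop Γ)) (a : K) : a ∈ valRing v ↔ 0 ≤ v a :=
  Iff.rfl

/-- The residue field of the valuation ring. -/
abbrev ResField (v : AddValuation K (WithTop Γ)) : Type _ :=
  IsLocalRing.ResidueField (valRing v)

/-- A differential field `K` with valuation `v` is a valued differential field with value
group `Γ`: every element of `Γ` is the valuation of a nonzero element (nonzero is automatic, as
`v 0 = ⊤`), and the residue field has characteristic zero. -/
structure IsValuedDifferentialField (v : AddValuation K (WithTop Γ)) : Prop where
  surj : ∀ γ : Γ, ∃ a : K, v a = γ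
  charZero : CharZero (ResField v)

/-- `v` is monotone: `v (a′) ≥ v a` for all `a`. In particular the derivation is small and maps
the valuation ring into itself. -/
def IsMonotone [Differential K] (v : AddValuation K (WithTop Γ)) : Prop :=
  ∀ a : K, v a ≤ v (a′)

/-- Differential-henselianity: every differential polynomial over the valuation ring whose
reduction to the residue field has total degree `1` has a zero in the valuation ring.
The ring of differential polynomials `𝒪{Y} = 𝒪[Y, Y′, Y″, …]` is `MvPolynomial ℕ 𝒪`, with
`MvPolynomial.X n` standing for the `n`-th derivative of `Y`; it is evaluated in `K` at
`(y, y′, y″, …)`. -/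
def IsDHenselian [Differential K] (v : AddValuation K (WithTop Γ)) : Prop :=
  ∀ P : MvPolynomial ℕ (valRing v),
    (MvPolynomial.map (IsLocalRing.residue (valRing v)) P).totalDegree = 1 →
    ∃ y ∈ valRing v, MvPolynomial.aeval (fun n => (fun a : K => a′)^[n] y) P = 0

/-- `k` is a lift of the differential residue field: a differential subfield of `K` contained in
the valuation ring that is mapped bijectively onto the residue field by the residue map.
The derivation of the residue field is the one induced by that of `K`, so that this
bijection is an isomorphism of differential fields. -/
structure IsLift [Differential K] (v : AddValuation K (WithTop Γ)) (k : Subfield K) : Prop where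
  deriv_mem : ∀ a ∈ k, a′ ∈ k
  le_valRing : ∀ a ∈ k, a ∈ valRing v
  bijective : Function.Bijective
    fun a : k => IsLocalRing.residue (valRing v) ⟨a, le_valRing a a.2⟩

/-! ### The two-sorted structure `((K, k), Γ; v)`

As usual, a structure with sorts `K` and `Γ` is construed as a one-sorted structure on the disjoint
union of `K` and `Γ`, with predicates for the two sorts and with (possibly partial) operations given by
their graphs. -/

/-- The relation symbols: the two sorts, the distinguished subset of the field sort, the graph of
the derivation, the graph of the valuation on nonzero field elements, the order of the value
group, and the graphs of the field addition, the field multiplication and the group addition. -/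
inductive Rel : ℕ → Type
  | fieldSort : Rel 1
  | groupSort : Rel 1
  | lift : Rel 1
  | deriv : Rel 2
  | val : Rel 2
  | groupLe : Rel 2
  | fieldAdd : Rel 3
  | fieldMul : Rel 3
  | groupAdd : Rel 3

/-- The language of the structures `((K, k), Γ; v)`. -/
abbrev lang : FirstOrder.Language.{0, 0} := ⟨fun _ => Empty, Rel⟩

/-- The underlying set of the structure `((K, k), Γ; v)`: the disjoint union of `K` and `Γ`. The
parameters `v` and `k` do not affect this set; they determine the interpretation of the symbols. -/
inductive Pair (v : AddValuation K (WithTop Γ)) (k : Subfield K) : Type _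
  | field (a : K) : Pair v k
  | group (γ : Γ) : Pair v k

instance [Differential K] (v : AddValuation K (WithTop Γ)) (k : Subfield K) :
    lang.Structure (Pair v k) where
  funMap f := nomatch f
  RelMap
    | Rel.fieldSort => fun x => ∃ a : K, x 0 = Pair.field a
    | Rel.groupSort => fun x => ∃ γ : Γ, x 0 = Pair.group γ
    | Rel.lift => fun x => ∃ a ∈ k, x 0 = Pair.field a
    | Rel.deriv => fun x => ∃ a : K, x 0 = Pair.field a ∧ x 1 = Pair.field (a′)
    | Rel.val => fun x => ∃ (a : K) (γ : Γ), v a = γ ∧ x 0 = Pair.field a ∧ x 1 = Pair.group γ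
    | Rel.groupLe => fun x => ∃ γ δ : Γ, γ ≤ δ ∧ x 0 = Pair.group γ ∧ x 1 = Pair.group δ
    | Rel.fieldAdd => fun x => ∃ a b : K,
        x 0 = Pair.field a ∧ x 1 = Pair.field b ∧ x 2 = Pair.field (a + b)
    | Rel.fieldMul => fun x => ∃ a b : K,
        x 0 = Pair.field a ∧ x 1 = Pair.field b ∧ x 2 = Pair.field (a * b)
    | Rel.groupAdd => fun x => ∃ γ δ : Γ,
        x 0 = Pair.group γ ∧ x 1 = Pair.group δ ∧ x 2 = Pair.group (γ + δ)

/-! ### Cross-sections -/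

/-- `s : Γ → Kˣ` is a cross-section of `v`: a group morphism with `v (s γ) = γ`. -/
def IsCrossSection (v : AddValuation K (WithTop Γ)) (s : Multiplicative Γ →* Kˣ) : Prop :=
  ∀ γ : Γ, v (s (Multiplicative.ofAdd γ) : K) = γ

end ValDiff

/-!
Let `G` be the group of the `a ∈ Kˣ` with `a† ∈ k`. A group morphism `Γ → G` splitting the valuation
is a cross-section `s` with `s(γ)† ∈ k`, and `γ ↦ s(γ)†` is then additive.

The valuation maps `G` onto `Γ`: if `v b = γ`, then `b†` lies in `𝒪` by monotonicity, so
`b† = c + ε` with `c ∈ k` and `v ε > 0`. A first-order linear differential equation over `𝒪` yields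
`u` with `v u = 0` and `u† = -ε`, and then `b u ∈ G` has value `γ`.

The kernel of `G → Γ` is definable in `((K, k), Γ; v)`. In an `ℵ₁`-saturated structure every
countable system `xₙ = hₙ + (n + 1) xₙ₊₁` over a definable abelian group can be solved, because its
finite subsystems can be solved backwards from the last unknown. Hence the kernel `A` satisfies
`Ext¹(ℚ, A) = 0`, and so `Ext¹(Γ, A) = 0`, as the torsion-free group `Γ` embeds into a
`ℚ`-vector space.
-/

section Cotorsion

open Filter
open scoped Nat

/-- An abelian group `A` is cotorsion if every extension of `ℚ` by `A` splits. The encoding is the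
vanishing of `Ext¹(ℚ, A)`, computed as the `lim¹` of the tower `A ← A ← A ← ⋯` whose `n`-th map is
multiplication by `n + 1`. -/
def IsCotorsion (A : Type*) [AddCommGroup A] : Prop :=
  ∀ h : ℕ → A, ∃ x : ℕ → A, ∀ n, x n = h n + (n + 1) • x (n + 1)

theorem IsCotorsion.of_surjective {A B : Type*} [AddCommGroup A] [AddCommGroup B]
    (hA : IsCotorsion A) {f : A →+ B} (hf : Function.Surjective f) : IsCotorsion B := by
  intro h
  choose a ha using fun n => hf (h n)
  obtain ⟨x, hx⟩ := hA a
  refine ⟨f ∘ x, fun n => ?_⟩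
  rw [Function.comp_apply, hx n, map_add, map_nsmul, ha, Function.comp_apply]

theorem rat_eq_zsmul_one_div_factorial (q : ℚ) :
    q = (q.num * (q.den - 1)!) • (1 / q.den ! : ℚ) := by
  have hden : (q.den ! : ℚ) = q.den * (q.den - 1)! := by
    exact_mod_cast (Nat.mul_factorial_pred q.den_nz).symm
  have hpred : ((q.den - 1)! : ℚ) ≠ 0 := by positivity
  rw [zsmul_eq_mul, hden, mul_one_div]
  push_cast
  rw [mul_div_mul_right _ _ hpred, Rat.num_div_den]

theorem one_div_factorial_eq_nsmul (n : ℕ) :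
    (1 / n ! : ℚ) = (n + 1) • (1 / (n + 1)! : ℚ) := by
  rw [Nat.factorial_succ, nsmul_eq_mul]
  push_cast
  field_simp

theorem rat_addMonoidHom_ext {D : Type*} [AddCommGroup D] {f g : ℚ →+ D}
    (h : ∀ n : ℕ, f (1 / n !) = g (1 / n !)) : f = g := by
  ext q
  rw [rat_eq_zsmul_one_div_factorial q, map_zsmul, map_zsmul, h]

theorem exists_rat_addMonoidHom {D : Type*} [AddCommGroup D] (d : ℕ → D)
    (hd : ∀ n, d n = (n + 1) • d (n + 1)) : ∃ ψ : ℚ →+ D, ∀ n : ℕ, ψ (1 / n !) = d n := by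
  let IsImage (q : ℚ) (y : D) : Prop := ∀ᶠ n : ℕ in atTop, ∃ a : ℤ, a = q * n ! ∧ a • d n = y
  have isImage_zsmul (n : ℕ) (a : ℤ) : IsImage (a • (1 / n !)) (a • d n) := by
    refine eventually_atTop.2 ⟨n, fun m hm => ?_⟩
    induction m, hm using Nat.le_induction with
    | base => exact ⟨a, by rw [zsmul_eq_mul]; field_simp, rfl⟩
    | succ m _ ih =>
      obtain ⟨b, hb, hbd⟩ := ih
      refine ⟨b * (m + 1), ?_, ?_⟩
      · rw [Nat.factorial_succ]
        push_cast
        rw [hb]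
        ring
      · rw [← hbd, hd m, mul_smul]
        norm_cast
  have isImage_unique {q : ℚ} {y z : D} (hy : IsImage q y) (hz : IsImage q z) : y = z := by
    obtain ⟨n, ⟨a, ha, rfl⟩, b, hb, rfl⟩ := (hy.and hz).exists
    rw [Int.cast_injective (ha.trans hb.symm)]
  have isImage_add {p q : ℚ} {y z : D} (hy : IsImage p y) (hz : IsImage q z) :
      IsImage (p + q) (y + z) := by
    filter_upwards [hy, hz] with n ⟨a, ha, hay⟩ ⟨b, hb, hbz⟩
    exact ⟨a + b, by rw [Int.cast_add, ha, hb, add_mul], by rw [add_smul, hay, hbz]⟩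
  have exists_isImage (q : ℚ) : ∃ y, IsImage q y := by
    rw [rat_eq_zsmul_one_div_factorial q]
    exact ⟨_, isImage_zsmul _ _⟩
  choose ψ hψ using exists_isImage
  refine ⟨AddMonoidHom.mk' ψ fun p q => isImage_unique (hψ _) (isImage_add (hψ p) (hψ q)),
    fun n => isImage_unique (hψ _) ?_⟩
  simpa using isImage_zsmul n 1

section Lift

variable {V Γ D Q : Type*} [AddCommGroup V] [AddCommGroup Γ] [AddCommGroup D] [AddCommGroup Q]
  {π : D →+ Q}

theorem IsCotorsion.exists_lift_rat (hker : IsCotorsion π.ker) (hπ : Function.Surjective π)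
    (g : ℚ →+ Q) : ∃ ψ : ℚ →+ D, π.comp ψ = g := by
  choose d hd using fun n : ℕ => hπ (g (1 / n !))
  have hdefect (n : ℕ) : d n - (n + 1) • d (n + 1) ∈ π.ker := by
    rw [AddMonoidHom.mem_ker, map_sub, map_nsmul, hd, hd, one_div_factorial_eq_nsmul n,
      map_nsmul, sub_self]
  obtain ⟨x, hx⟩ := hker fun n => ⟨_, hdefect n⟩
  obtain ⟨ψ, hψ⟩ := exists_rat_addMonoidHom (fun n => d n - x n) fun n => by
    rw [hx n, smul_sub]
    push_cast
    abel
  refine ⟨ψ, rat_addMonoidHom_ext fun n => ?_⟩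
  rw [AddMonoidHom.comp_apply, hψ, map_sub, (x n).2, sub_zero, hd]

theorem IsCotorsion.exists_lift_rat_module [Module ℚ V] (hker : IsCotorsion π.ker)
    (hπ : Function.Surjective π) (g : V →+ Q) : ∃ ψ : V →+ D, π.comp ψ = g := by
  let e : V ≃+ (_ →₀ ℚ) := (Module.Basis.ofVectorSpace ℚ V).repr.toAddEquiv
  choose ψ hψ using fun i =>
    hker.exists_lift_rat hπ ((g.comp e.symm.toAddMonoidHom).comp (Finsupp.singleAddHom i))
  refine ⟨(Finsupp.liftAddHom ψ).comp e.toAddMonoidHom, ?_⟩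
  have hcoord : π.comp (Finsupp.liftAddHom ψ) = g.comp e.symm.toAddMonoidHom :=
    Finsupp.addHom_ext fun i q => by simpa using DFunLike.congr_fun (hψ i) q
  rw [← AddMonoidHom.comp_assoc, hcoord]
  ext x
  simp

theorem IsCotorsion.exists_lift_of_divisibleBy [IsAddTorsionFree Γ] [DivisibleBy D ℤ]
    (hker : IsCotorsion π.ker) (hπ : Function.Surjective π) (g : Γ →+ Q) :
    ∃ ψ : Γ →+ D, π.comp ψ = g := by
  let _ : DivisibleBy Q ℤ := hπ.divisibleBy π fun a n => map_zsmul π n a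
  obtain ⟨g', hg'⟩ := (Module.Baer.of_divisible Q).extension_property_addMonoidHom
    (DivisibleHull.coeAddMonoidHom Γ) DivisibleHull.coe_injective g
  obtain ⟨ψ, hψ⟩ := hker.exists_lift_rat_module hπ g'
  exact ⟨ψ.comp (DivisibleHull.coeAddMonoidHom Γ), by rw [← AddMonoidHom.comp_assoc, hψ, hg']⟩

end Lift

theorem exists_injective_addMonoidHom_divisibleBy.{u} (G : Type u) [AddCommGroup G] :
    ∃ (D : Type u) (_ : AddCommGroup D) (_ : DivisibleBy D ℤ) (ι : G →+ D),
      Function.Injective ι := by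
  have : Fact ((0 : ℚ) < 1) := ⟨one_pos⟩
  refine ⟨CharacterModule G → AddCircle (1 : ℚ), inferInstance, inferInstance,
    AddMonoidHom.pi fun χ => χ, (injective_iff_map_eq_zero _).2 fun a ha => ?_⟩
  exact CharacterModule.eq_zero_of_character_apply fun χ => congrFun ha χ

theorem IsCotorsion.exists_section {G Γ : Type*} [AddCommGroup G] [AddCommGroup Γ]
    [IsAddTorsionFree Γ] {f : G →+ Γ} (hker : IsCotorsion f.ker) (hf : Function.Surjective f) :
    ∃ s : Γ →+ G, ∀ γ, f (s γ) = γ := by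
  -- Since `ι` identifies `f.ker` with `π.ker`, a lift of `Γ ≃ G ⧸ f.ker → D ⧸ π.ker` to `D` takes
  -- its values in `ι G`.
  obtain ⟨D, _, _, ι, hι⟩ := exists_injective_addMonoidHom_divisibleBy G
  let π := QuotientAddGroup.mk' (f.ker.map ι)
  have hπker : IsCotorsion π.ker := by
    rw [QuotientAddGroup.ker_mk']
    exact hker.of_surjective (f := (f.ker.equivMapOfInjective ι hι).toAddMonoidHom)
      (f.ker.equivMapOfInjective ι hι).surjective
  let g : Γ →+ D ⧸ f.ker.map ι := f.liftOfSurjective hf ⟨π.comp ι, fun a ha =>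
    (QuotientAddGroup.eq_zero_iff _).2 (AddSubgroup.mem_map_of_mem ι ha)⟩
  have hg (a : G) : g (f a) = π (ι a) := AddMonoidHom.liftOfRightInverse_comp_apply ..
  obtain ⟨ψ, hψ⟩ := hπker.exists_lift_of_divisibleBy (QuotientAddGroup.mk'_surjective _) g
  have hrange (γ : Γ) : ∃ a, ι a = ψ γ ∧ f a = γ := by
    obtain ⟨a, rfl⟩ := hf γ
    have hπψ : π (ι a) = π (ψ (f a)) := by rw [← hg, ← hψ, AddMonoidHom.comp_apply]
    obtain ⟨b, hb, hab⟩ := QuotientAddGroup.eq.1 hπψ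
    exact ⟨a + b, by rw [map_add, hab, add_neg_cancel_left], by
      rw [map_add, AddMonoidHom.mem_ker.1 hb, add_zero]⟩
  choose s hs hfs using hrange
  exact ⟨AddMonoidHom.mk' s fun γ δ => hι (by simp only [map_add, hs]), hfs⟩

end Cotorsion

section Saturation

open Set

variable {L : FirstOrder.Language.{0, 0}} {M : Type*} [L.Structure M] {A : Set M}

theorem nonempty_iInter_of_isSaturated {κ : Cardinal} (hM : L.IsSaturated M κ)
    (hA : Cardinal.mk A < κ) {ι : Type*} {S : ι → Set M} (hS : ∀ i, A.Definable₁ L (S i))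
    (hfin : ∀ t : Finset ι, (⋂ i ∈ t, S i).Nonempty) : (⋂ i, S i).Nonempty := by
  choose φ hφ using fun i =>
    definable_iff_exists_formula_sum.1 ((hS i).preimage_comp fun _ : Fin 1 => ())
  have realize_iff (i : ι) (x : M) :
      (φ i).Realize (Sum.elim Subtype.val fun _ => x) ↔ x ∈ S i :=
    (Set.ext_iff.1 (hφ i) fun _ => x).symm
  obtain ⟨x, hx⟩ := hM A hA (range φ) fun q hq hqfin => by
    classical
    obtain ⟨q, rfl⟩ := hqfin.exists_finset_coe
    obtain ⟨t, -, rfl⟩ := Finset.subset_set_image_iff.1 (image_univ (f := φ) ▸ hq)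
    obtain ⟨x, hx⟩ := hfin t
    refine ⟨x, fun ψ hψ => ?_⟩
    obtain ⟨i, hi, rfl⟩ := Finset.mem_image.1 (Finset.mem_coe.1 hψ)
    exact (realize_iff i x).2 (mem_iInter₂.1 hx i hi)
  exact ⟨x, mem_iInter.2 fun i => (realize_iff i x).1 (hx _ ⟨i, rfl⟩)⟩

theorem nonempty_iInter_of_isSaturated_of_antitone
    (hM : L.IsSaturated M (Cardinal.aleph 1)) (hA : A.Countable)
    {S : ℕ → Set M} (hS : ∀ n, A.Definable₁ L (S n)) (hanti : Antitone S)
    (hne : ∀ n, (S n).Nonempty) : (⋂ n, S n).Nonempty := by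
  have hcard : Cardinal.mk A < Cardinal.aleph 1 :=
    (Cardinal.le_aleph0_iff_set_countable.2 hA).trans_lt Cardinal.aleph0_lt_aleph_one
  exact nonempty_iInter_of_isSaturated hM hcard hS fun t =>
    (hne (t.sup id)).mono (subset_iInter₂ fun _ hn => hanti (Finset.le_sup (f := id) hn))

theorem definable_relMap (A : Set M) {n : ℕ} (R : L.Relations n) {α : Type*} (g : Fin n → α) :
    A.Definable L {w : α → M | FirstOrder.Language.Structure.RelMap R (w ∘ g)} := by
  refine (Set.empty_definable_iff.2 ⟨R.formula fun i => .var (g i), ?_⟩).mono (empty_subset A)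
  ext w
  exact (FirstOrder.Language.Formula.realize_rel (v := w) (ts := fun i => .var (g i))).symm

theorem definable₁_preimage {R : SetRel M M} {S : Set M} (hR : A.Definable₂ L R)
    (hS : A.Definable₁ L S) : A.Definable₁ L (R.preimage S) := by
  rw [Definable₁]
  convert ((hR.preimage_comp ![Sum.inl 0, Sum.inr ()]).inter
    (hS.preimage_comp fun _ => Sum.inr ())).exists_of_finite (α := Fin 1) (β := Unit) using 1
  ext w
  exact ⟨fun ⟨z, hz, hR⟩ => ⟨fun _ => z, hR, hz⟩, fun ⟨u, hR, hz⟩ => ⟨u (), hz, hR⟩⟩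

theorem definable₁_image {R : SetRel M M} {S : Set M} (hR : A.Definable₂ L R)
    (hS : A.Definable₁ L S) : A.Definable₁ L (R.image S) :=
  definable₁_preimage (R := R.inv) (hR.preimage_comp ![1, 0]) hS

/-- The elements from which a chain of length `m` can be started for the relations
`R n, R (n + 1), …`. -/
def chainStart (R : ℕ → SetRel M M) : ℕ → ℕ → Set M
  | 0, _ => univ
  | m + 1, n => (R n).preimage (chainStart R m (n + 1))

theorem chainStart_antitone (R : ℕ → SetRel M M) (n : ℕ) :
    Antitone fun m => chainStart R m n := by
  refine antitone_nat_of_succ_le fun m => ?_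
  induction m generalizing n with
  | zero => exact subset_univ _
  | succ m ih => exact SetRel.preimage_subset_preimage (ih (n + 1))

theorem mem_chainStart_of_forall_rel {R : ℕ → SetRel M M} {x : ℕ → M} (m n : ℕ)
    (hx : ∀ i < n + m, (x i, x (i + 1)) ∈ R i) : x n ∈ chainStart R m n := by
  induction m generalizing n with
  | zero => exact mem_univ _
  | succ m ih =>
    exact ⟨x (n + 1), ih (n + 1) fun i hi => hx i (by lia), hx n (by lia)⟩

theorem definable₁_chainStart {R : ℕ → SetRel M M} (hR : ∀ n, A.Definable₂ L (R n)) (m n : ℕ) :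
    A.Definable₁ L (chainStart R m n) := by
  induction m generalizing n with
  | zero => exact definable_univ
  | succ m ih => exact definable₁_preimage (hR n) (ih (n + 1))

theorem exists_chain_of_isSaturated (hM : L.IsSaturated M (Cardinal.aleph 1)) (hA : A.Countable)
    {R : ℕ → SetRel M M} (hR : ∀ n, A.Definable₂ L (R n))
    (hfin : ∀ N, ∃ x : ℕ → M, ∀ n < N, (x n, x (n + 1)) ∈ R n) :
    ∃ x : ℕ → M, ∀ n, (x n, x (n + 1)) ∈ R n := by
  -- Elements that start arbitrarily long finite chains: saturation gives such an element at `0`,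
  -- and a successor of the same kind for each such element.
  let T (n : ℕ) : Set M := ⋂ m, chainStart R m n
  obtain ⟨x₀, hx₀⟩ : (T 0).Nonempty :=
    nonempty_iInter_of_isSaturated_of_antitone hM hA (fun m => definable₁_chainStart hR m 0)
      (chainStart_antitone R 0) fun m =>
        let ⟨x, hx⟩ := hfin m
        ⟨x 0, mem_chainStart_of_forall_rel m 0 (by simpa using hx)⟩
  have exists_next (n : ℕ) (y : M) (hy : y ∈ T n) : ∃ z ∈ T (n + 1), (y, z) ∈ R n := by
    have hdef (m : ℕ) :
        (insert y A).Definable₁ L ((R n).image {y} ∩ chainStart R m (n + 1)) :=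
      (definable₁_image ((hR n).mono (subset_insert _ _))
        (Definable.singleton_of_mem L (mem_insert _ _))).inter
        ((definable₁_chainStart hR m (n + 1)).mono (subset_insert _ _))
    obtain ⟨z, hz⟩ := nonempty_iInter_of_isSaturated_of_antitone hM (hA.insert y) hdef
      (fun _ _ h => inter_subset_inter_right _ (chainStart_antitone R (n + 1) h)) fun m =>
        let ⟨z, hz, hyz⟩ := mem_iInter.1 hy (m + 1)
        ⟨z, ⟨y, rfl, hyz⟩, hz⟩
    obtain ⟨⟨_, rfl, hyz⟩, -⟩ := mem_iInter.1 hz 0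
    exact ⟨z, mem_iInter.2 fun m => (mem_iInter.1 hz m).2, hyz⟩
  choose! next next_mem rel_next using exists_next
  let x : ℕ → M := fun n => Nat.rec x₀ next n
  have hx (n : ℕ) : x n ∈ T n := by
    induction n with
    | zero => exact hx₀
    | succ n ih => exact next_mem n (x n) ih
  exact ⟨x, fun n => rel_next n (x n) (hx n)⟩

theorem exists_forall_lt_eq {X : Type*} [Nonempty X] (f : ℕ → X → X) (N : ℕ) :
    ∃ x : ℕ → X, ∀ n < N, x n = f n (x (n + 1)) := by
  induction N generalizing f with
  | zero => exact ⟨fun _ => Classical.arbitrary X, fun n hn => absurd hn n.not_lt_zero⟩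
  | succ N ih =>
    obtain ⟨x, hx⟩ := ih fun n => f (n + 1)
    refine ⟨fun n => Nat.casesOn n (f 0 (x 0)) x, fun n hn => ?_⟩
    cases n with
    | zero => rfl
    | succ n => exact hx n (Nat.lt_of_succ_lt_succ hn)

theorem definable_add_succ_nsmul {G : Type*} [AddMonoid G] {e : G → M}
    (he : Function.Injective e)
    (hadd : A.Definable L {w : Fin 3 → M | ∃ a b, w 0 = e a ∧ w 1 = e b ∧ w 2 = e (a + b)})
    (j : ℕ) :
    A.Definable L
      {w : Fin 3 → M | ∃ a b, w 0 = e a ∧ w 1 = e b ∧ w 2 = e (a + (j + 1) • b)} := by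
  induction j with
  | zero => simpa using hadd
  | succ j ih =>
    convert ((ih.preimage_comp ![Sum.inl 0, Sum.inl 1, Sum.inr ()]).inter
      (hadd.preimage_comp ![Sum.inr (), Sum.inl 1, Sum.inl 2])).exists_of_finite
      (α := Fin 3) (β := Unit) using 1
    ext w
    constructor
    · rintro ⟨a, b, ha, hb, hab⟩
      refine ⟨fun _ => e (a + (j + 1) • b), ⟨a, b, ha, hb, rfl⟩, _, b, rfl, hb, ?_⟩
      rw [add_assoc, ← succ_nsmul]
      exact hab
    · rintro ⟨u, ⟨a, b, ha, hb, hab⟩, c, b', hc, hb', hcb⟩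
      obtain rfl : c = a + (j + 1) • b := he (hc.symm.trans hab)
      obtain rfl : b' = b := he (hb'.symm.trans hb)
      rw [add_assoc, ← succ_nsmul] at hcb
      exact ⟨a, b', ha, hb, hcb⟩

theorem isCotorsion_of_isSaturated (hM : L.IsSaturated M (Cardinal.aleph 1)) (hA : A.Countable)
    {G : Type*} [AddCommGroup G] {e : G → M} (he : Function.Injective e)
    (hadd : A.Definable L {w : Fin 3 → M | ∃ a b, w 0 = e a ∧ w 1 = e b ∧ w 2 = e (a + b)}) :
    IsCotorsion G := by
  intro h
  let B := A ∪ range (e ∘ h)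
  let R (n : ℕ) : SetRel M M := {p | ∃ b, p.1 = e (h n + (n + 1) • b) ∧ p.2 = e b}
  have hR (n : ℕ) : B.Definable₂ L (R n) := by
    have hgraph := (definable_add_succ_nsmul he hadd n).mono (subset_union_left : A ⊆ B)
    have hparam : B.Definable₁ L {e (h n)} :=
      Definable.singleton_of_mem L (subset_union_right ⟨n, rfl⟩)
    rw [Definable₂]
    convert ((hgraph.preimage_comp ![Sum.inr (), Sum.inl 1, Sum.inl 0]).inter
      (hparam.preimage_comp fun _ => Sum.inr ())).exists_of_finite
      (α := Fin 2) (β := Unit) using 1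
    ext w
    constructor
    · rintro ⟨b, hab, hb⟩
      exact ⟨fun _ => e (h n), ⟨h n, b, rfl, hb, hab⟩, rfl⟩
    · rintro ⟨u, ⟨a, b, ha, hb, hab⟩, hu⟩
      obtain rfl : a = h n := he (ha.symm.trans hu)
      exact ⟨b, hab, hb⟩
  have hfin (N : ℕ) : ∃ x : ℕ → M, ∀ n < N, (x n, x (n + 1)) ∈ R n := by
    obtain ⟨x, hx⟩ := exists_forall_lt_eq (fun n b => h n + (n + 1) • b) N
    exact ⟨e ∘ x, fun n hn => ⟨x (n + 1), congrArg e (hx n hn), rfl⟩⟩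
  obtain ⟨x, hx⟩ := exists_chain_of_isSaturated hM (hA.union (countable_range _)) hR hfin
  choose y hxy hy using hx
  have hy_succ (n : ℕ) : y n = h (n + 1) + (n + 2) • y (n + 1) :=
    he ((hy n).symm.trans (hxy (n + 1)))
  exact ⟨fun n => h n + (n + 1) • y n, fun n => congrArg (h n + (n + 1) • ·) (hy_succ n)⟩

end Saturation

namespace ValDiff

variable {K Γ : Type*} [Field K] [AddCommGroup Γ] [LinearOrder Γ] [IsOrderedAddMonoid Γ]
  {v : AddValuation K (WithTop Γ)} {k : Subfield K}

section LinearEquations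

theorem ne_zero_of_val_eq_coe {a : K} {γ : Γ} (ha : v a = γ) : a ≠ 0 :=
  (AddValuation.ne_top_iff v).1 (ha ▸ WithTop.coe_ne_top)

theorem val_div_nonneg {a b : K} (h : v b ≤ v a) : 0 ≤ v (a / b) := by
  rcases eq_or_ne b 0 with rfl | hb
  · rw [div_zero, v.map_zero]
    exact le_top
  · refine (WithTop.add_le_add_iff_left ((AddValuation.ne_top_iff v).2 hb)).1 ?_
    rwa [add_zero, ← v.map_mul, mul_div_cancel₀ _ hb]

theorem residue_eq_zero_iff (a : valRing v) :
    IsLocalRing.residue (valRing v) a = 0 ↔ 0 < v (a : K) :=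
  (IsLocalRing.residue_eq_zero_iff a).trans (Valuation.mem_maximalIdeal_iff _ _)

variable [Differential K]

theorem IsMonotone.val_logDeriv_nonneg (hmono : IsMonotone v) (a : K) :
    0 ≤ v (Differential.logDeriv a) :=
  val_div_nonneg (hmono a)

theorem IsLift.exists_val_sub_pos (hlift : IsLift v k) {a : K} (ha : a ∈ valRing v) :
    ∃ c ∈ k, 0 < v (a - c) := by
  obtain ⟨c, hc⟩ := hlift.bijective.2 (IsLocalRing.residue (valRing v) ⟨a, ha⟩)
  let c' : valRing v := ⟨c, hlift.le_valRing c c.2⟩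
  refine ⟨c, c.2, (residue_eq_zero_iff (⟨a, ha⟩ - c')).1 ?_⟩
  rw [map_sub, ← hc, sub_self]

open MvPolynomial in
theorem totalDegree_X_one_add_C_mul_X_zero_sub_one {R : Type*} [CommRing R] [Nontrivial R]
    (e : R) : (X 1 + C e * X 0 - 1 : MvPolynomial ℕ R).totalDegree = 1 := by
  refine le_antisymm ?_ ?_
  · refine (totalDegree_sub _ _).trans (max_le ((totalDegree_add _ _).trans (max_le ?_ ?_)) ?_)
    · exact (totalDegree_X 1).le
    · exact (totalDegree_mul _ _).trans (by simp)
    · simp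
  · have hcoeff : (X 1 + C e * X 0 - 1 : MvPolynomial ℕ R).coeff (Finsupp.single 1 1) = 1 := by
      simp [coeff_X, coeff_C_mul, coeff_one, Finsupp.single_left_inj,
        eq_comm (a := (0 : ℕ →₀ ℕ))]
    exact (Finsupp.sum_single_index rfl).ge.trans
      (le_totalDegree (mem_support_iff.2 (hcoeff ▸ one_ne_zero)))

theorem IsDHenselian.exists_deriv_add_mul_eq_one (hdh : IsDHenselian v) {e : K}
    (he : e ∈ valRing v) : ∃ z ∈ valRing v, z′ + e * z = 1 := by
  obtain ⟨z, hz, hroot⟩ :=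
    hdh (MvPolynomial.X 1 + MvPolynomial.C ⟨e, he⟩ * MvPolynomial.X 0 - 1) (by
      simpa only [map_sub, map_add, map_mul, MvPolynomial.map_X, MvPolynomial.map_C, map_one]
        using totalDegree_X_one_add_C_mul_X_zero_sub_one _)
  refine ⟨z, hz, sub_eq_zero.1 ?_⟩
  simpa using hroot

theorem exists_val_eq_zero_logDeriv_eq_neg (hmono : IsMonotone v)
    (hlin : ∀ e ∈ valRing v, ∃ z ∈ valRing v, z′ + e * z = 1) {ε : K} (hε : 0 < v ε) :
    ∃ u, v u = 0 ∧ Differential.logDeriv u = -ε := by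
  rcases eq_or_ne ε 0 with rfl | hε0
  · exact ⟨1, v.map_one, by simp⟩
  -- For `u = 1 - ε z`, the equation `u′ = -ε u` becomes `z′ + (ε† + ε) z = 1`.
  obtain ⟨z, hz, hz'⟩ := hlin (Differential.logDeriv ε + ε)
    (v.map_le_add (hmono.val_logDeriv_nonneg ε) hε.le)
  have hu : v (1 - ε * z) = 0 := by
    rw [v.map_sub_eq_of_lt_left, v.map_one]
    rw [v.map_one, v.map_mul]
    exact add_pos_of_pos_of_nonneg hε hz
  refine ⟨1 - ε * z, hu, (div_eq_iff (ne_zero_of_val_eq_coe hu)).2 ?_⟩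
  have hderiv : ε * z′ = ε - ε′ * z - ε * ε * z := by
    rw [Differential.logDeriv] at hz'
    field_simp at hz'
    linear_combination hz'
  simp only [map_sub, Derivation.leibniz, smul_eq_mul, Derivation.map_one_eq_zero]
  linear_combination -hderiv

theorem exists_val_eq_logDeriv_mem (hsurj : ∀ γ : Γ, ∃ a : K, v a = γ) (hmono : IsMonotone v)
    (hres : ∀ a ∈ valRing v, ∃ c ∈ k, 0 < v (a - c))
    (hlin : ∀ e ∈ valRing v, ∃ z ∈ valRing v, z′ + e * z = 1) (γ : Γ) :
    ∃ a : K, v a = γ ∧ Differential.logDeriv a ∈ k := by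
  obtain ⟨b, hb⟩ := hsurj γ
  obtain ⟨c, hck, hc⟩ := hres _ (hmono.val_logDeriv_nonneg b)
  obtain ⟨u, hu, hu'⟩ := exists_val_eq_zero_logDeriv_eq_neg hmono hlin hc
  refine ⟨b * u, by rw [v.map_mul, hb, hu, add_zero], ?_⟩
  rwa [Differential.logDeriv_mul _ _ (ne_zero_of_val_eq_coe hb) (ne_zero_of_val_eq_coe hu), hu',
    neg_sub, add_sub_cancel]

end LinearEquations

section Homomorphisms

/-- The valuation as a homomorphism on the multiplicative group of `K`, written additively. -/
def valHom (v : AddValuation K (WithTop Γ)) : Additive Kˣ →+ Γ :=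
  AddMonoidHom.mk'
    (fun a => (v (a.toMul : K)).untop ((AddValuation.ne_top_iff v).2 a.toMul.ne_zero))
    fun a b => WithTop.coe_injective (by
      rw [WithTop.coe_add, WithTop.coe_untop, WithTop.coe_untop, WithTop.coe_untop, toMul_add,
        Units.val_mul, v.map_mul])

theorem coe_valHom (v : AddValuation K (WithTop Γ)) (a : Additive Kˣ) :
    (valHom v a : WithTop Γ) = v (a.toMul : K) :=
  WithTop.coe_untop _ _

/-- The logarithmic derivative as a homomorphism on the multiplicative group of `K`, written
additively. -/
def logDerivHom (K : Type*) [Field K] [Differential K] : Additive Kˣ →+ K :=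
  AddMonoidHom.mk' (fun a => Differential.logDeriv (a.toMul : K)) fun a b =>
    Differential.logDeriv_mul _ _ a.toMul.ne_zero b.toMul.ne_zero

/-- The group of the nonzero `a` with `a† ∈ k`, written additively. -/
def logDerivSubgroup [Differential K] (k : Subfield K) : AddSubgroup (Additive Kˣ) :=
  k.toAddSubgroup.comap (logDerivHom K)

end Homomorphisms

section Definability

theorem Pair.field_injective : Function.Injective (Pair.field : K → Pair v k) :=
  fun _ _ h => Pair.field.inj h

variable [Differential K]

theorem definable₁_val_eq_zero (A : Set (Pair v k)) :
    A.Definable₁ lang (Pair.field '' {a | v a = 0}) := by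
  -- An element `γ` of `Γ` is `0` if and only if `γ + γ = γ`.
  rw [Set.Definable₁]
  convert ((definable_relMap (L := lang) A Rel.val ![Sum.inl 0, Sum.inr ()]).inter
    (definable_relMap (L := lang) A Rel.groupAdd fun _ => Sum.inr ())).exists_of_finite
    (α := Fin 1) (β := Unit) using 1
  ext w
  constructor
  · rintro ⟨a, ha, hw⟩
    exact ⟨fun _ => .group 0, ⟨a, 0, ha, hw.symm, rfl⟩, 0, 0, rfl, rfl, by rw [add_zero]; rfl⟩
  · rintro ⟨u, ⟨a, γ, ha, hw, hγ⟩, δ, δ', hδ, hδ', hadd⟩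
    obtain rfl : γ = δ := Pair.group.inj (hγ.symm.trans hδ)
    obtain rfl : γ = δ' := Pair.group.inj (hγ.symm.trans hδ')
    have hγ0 : γ = 0 := left_eq_add.1 (Pair.group.inj (hγ.symm.trans hadd))
    exact ⟨a, by rw [Set.mem_ofPred_eq, ha, hγ0, WithTop.coe_zero], hw.symm⟩

theorem definable₁_logDeriv_mem (A : Set (Pair v k)) :
    A.Definable₁ lang (Pair.field '' {a | Differential.logDeriv a ∈ k}) := by
  -- `a† ∈ k` if and only if `a′ = c a` for some `c ∈ k`; for `a = 0` this uses `0† = 0′ / 0 = 0`.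
  rw [Set.Definable₁]
  convert (((definable_relMap (L := lang) A Rel.lift ![Sum.inr 0]).inter
    (definable_relMap (L := lang) A Rel.deriv ![Sum.inl 0, Sum.inr 1])).inter
    (definable_relMap (L := lang) A Rel.fieldMul
      ![Sum.inr 0, Sum.inl 0, Sum.inr 1])).exists_of_finite (α := Fin 1) (β := Fin 2) using 1
  ext w
  constructor
  · rintro ⟨a, ha, hw⟩
    have hmul : Differential.logDeriv a * a = a′ := by
      rcases eq_or_ne a 0 with rfl | ha0
      · simp
      · exact div_mul_cancel₀ _ ha0
    exact ⟨![.field (Differential.logDeriv a), .field a′], ⟨⟨_, ha, rfl⟩, a, hw.symm, rfl⟩, _, a,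
      rfl, hw.symm, congrArg Pair.field hmul.symm⟩
  · rintro ⟨u, ⟨⟨c, hc, huc⟩, a, hw, hua⟩, c', a', huc', hw', hmul⟩
    obtain rfl : c = c' := Pair.field.inj (huc.symm.trans huc')
    obtain rfl : a = a' := Pair.field.inj (hw.symm.trans hw')
    have hca : a′ = c * a := Pair.field.inj (hua.symm.trans hmul)
    refine ⟨a, ?_, hw.symm⟩
    rcases eq_or_ne a 0 with rfl | ha0
    · simp
    · rwa [Set.mem_ofPred_eq, Differential.logDeriv, hca, mul_div_cancel_right₀ _ ha0]

end Definability

section Splitting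

variable [Differential K]

/-- The valuation on the group of the nonzero `a` with `a† ∈ k`. -/
def valOnLogDerivSubgroup (v : AddValuation K (WithTop Γ)) (k : Subfield K) :
    logDerivSubgroup k →+ Γ :=
  (valHom v).comp (logDerivSubgroup k).subtype

theorem mem_ker_valOnLogDerivSubgroup {a : logDerivSubgroup k} :
    a ∈ (valOnLogDerivSubgroup v k).ker ↔ v (a.1.toMul : K) = 0 := by
  rw [AddMonoidHom.mem_ker, ← coe_valHom, ← WithTop.coe_zero, WithTop.coe_inj]
  rfl

theorem surjective_valOnLogDerivSubgroup
    (h : ∀ γ : Γ, ∃ a : K, v a = γ ∧ Differential.logDeriv a ∈ k) :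
    Function.Surjective (valOnLogDerivSubgroup v k) := by
  intro γ
  obtain ⟨a, hav, hak⟩ := h γ
  refine ⟨⟨Additive.ofMul (Units.mk0 a (ne_zero_of_val_eq_coe hav)), hak⟩, ?_⟩
  exact WithTop.coe_injective ((coe_valHom v _).trans hav)

theorem isCotorsion_ker_valOnLogDerivSubgroup
    (hsat : lang.IsSaturated (Pair v k) (Cardinal.aleph 1)) :
    IsCotorsion (valOnLogDerivSubgroup v k).ker := by
  let e (a : (valOnLogDerivSubgroup v k).ker) : Pair v k := .field (a.1.1.toMul : K)
  have he : Function.Injective e := fun a b h =>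
    Subtype.ext (Subtype.ext (Additive.toMul.injective (Units.ext (Pair.field_injective h))))
  have hrange : Set.range e =
      Pair.field '' {a | v a = 0} ∩ Pair.field '' {a | Differential.logDeriv a ∈ k} := by
    rw [← Set.image_inter Pair.field_injective]
    refine Set.Subset.antisymm ?_ ?_
    · rintro _ ⟨a, rfl⟩
      exact ⟨_, ⟨mem_ker_valOnLogDerivSubgroup.1 a.2, a.1.2⟩, rfl⟩
    · rintro _ ⟨a, ⟨hav, hak⟩, rfl⟩
      let a' : logDerivSubgroup k :=
        ⟨Additive.ofMul (Units.mk0 a (ne_zero_of_val_eq_coe hav)), hak⟩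
      exact ⟨⟨a', mem_ker_valOnLogDerivSubgroup.2 hav⟩, rfl⟩
  have hdef : Set.Definable₁ ∅ lang (Set.range e) :=
    hrange ▸ (definable₁_val_eq_zero ∅).inter (definable₁_logDeriv_mem ∅)
  refine isCotorsion_of_isSaturated hsat Set.countable_empty he ?_
  convert ((definable_relMap (L := lang) (α := Fin 3) ∅ Rel.fieldMul id).inter
    (hdef.preimage_comp fun _ => 0)).inter (hdef.preimage_comp fun _ => 1) using 1
  ext w
  constructor
  · rintro ⟨a, b, ha, hb, hab⟩
    exact ⟨⟨⟨_, _, ha, hb, hab⟩, a, ha.symm⟩, b, hb.symm⟩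
  · rintro ⟨⟨⟨x, y, hx, hy, hxy⟩, a, ha⟩, b, hb⟩
    obtain rfl : _ = x := Pair.field.inj (ha.trans hx)
    obtain rfl : _ = y := Pair.field.inj (hb.trans hy)
    exact ⟨a, b, hx, hy, hxy⟩

end Splitting

end ValDiff

theorem theorem3p5_general {K Γ : Type*} [Field K] [Differential K]
    [AddCommGroup Γ] [LinearOrder Γ] [IsOrderedAddMonoid Γ]
    (v : AddValuation K (WithTop Γ)) (k : Subfield K)
    (hsurj : ∀ γ : Γ, ∃ a : K, v a = γ)
    (hmono : ValDiff.IsMonotone v)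
    (hres : ∀ a ∈ ValDiff.valRing v, ∃ c ∈ k, 0 < v (a - c))
    (hlin : ∀ e ∈ ValDiff.valRing v, ∃ z ∈ ValDiff.valRing v, z′ + e * z = 1)
    (hsat : ValDiff.lang.IsSaturated (ValDiff.Pair v k) (Cardinal.aleph 1)) :
    ∃ (s : Multiplicative Γ →* Kˣ) (c : Γ →+ k),
      ValDiff.IsCrossSection v s ∧
      ∀ γ : Γ, Differential.logDeriv (s (Multiplicative.ofAdd γ) : K) = (c γ : K) := by
  obtain ⟨s, hs⟩ := (ValDiff.isCotorsion_ker_valOnLogDerivSubgroup hsat).exists_section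
    (ValDiff.surjective_valOnLogDerivSubgroup
      (ValDiff.exists_val_eq_logDeriv_mem hsurj hmono hres hlin))
  let s' : Γ →+ Additive Kˣ := (ValDiff.logDerivSubgroup k).subtype.comp s
  let c : Γ →+ k := ((ValDiff.logDerivHom K).comp s').codRestrict k.toAddSubgroup fun γ => (s γ).2
  have hcross (γ : Γ) : v ((s' γ).toMul : K) = γ := by
    rw [← ValDiff.coe_valHom]
    exact congrArg _ (hs γ)
  exact ⟨AddMonoidHom.toMultiplicativeLeft s', c, hcross, fun _ => rfl⟩

theorem theorem3p5 {K Γ : Type*} [Field K] [Differential K]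
    [AddCommGroup Γ] [LinearOrder Γ] [IsOrderedAddMonoid Γ]
    (v : AddValuation K (WithTop Γ)) (k : Subfield K)
    (hv : ValDiff.IsValuedDifferentialField v)
    (hmono : ValDiff.IsMonotone v)
    (hlift : ValDiff.IsLift v k)
    (hdh : ValDiff.IsDHenselian v)
    (hsat : ValDiff.lang.IsSaturated (ValDiff.Pair v k) (Cardinal.aleph 1)) :
    ∃ (s : Multiplicative Γ →* Kˣ) (c : Γ →+ k),
      ValDiff.IsCrossSection v s ∧
      ∀ γ : Γ, Differential.logDeriv (s (Multiplicative.ofAdd γ) : K) = (c γ : K) :=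
  theorem3p5_general v k hv.surj hmono (fun _ => hlift.exists_val_sub_pos)
    (fun _ => hdh.exists_deriv_add_mul_eq_one) hsat
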